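/- Let $X$ be an infinite-dimensional Banach space over $\mathbb{K}=\mathbb{R}$ or $\mathbb{K}=\mathbb{C}$ with the Dunford–Pettis property; that is, for every sequence $(x_n)_{n\in\mathbb{N}}$ in $X$ converging weakly to $0$ in $X$ and every sequence $(x_n^*)_{n\in\mathbb{N}}$ in the dual $X^*$ converging weakly (i.e. for $\sigma(X^*,X^{**})$) to $0$ in $X^*$, one has $x_n^*(x_n)\to 0$. Then $X^*$ (with the dual norm) contains a closed linear subspace that is isomorphic to $\ell_1$ (the space of absolutely summable sequences in $\mathbb{K}$ with its usual norm), i.e. that is linearly homeomorphic to $\ell_1$. -/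

import Mathlib

open Filter Topology

/-- The sequence `x` converges weakly to `0` in the normed space `E`,
that is, in the topology `σ(E, E*)`. -/
def WeaklyNull (𝕜 : Type*) {E : Type*} [RCLike 𝕜] [NormedAddCommGroup E] [NormedSpace 𝕜 E]
    (x : ℕ → E) : Prop :=
  Tendsto (fun n => toWeakSpace 𝕜 E (x n)) atTop (𝓝 0)

/-- The Dunford–Pettis property: `f n (x n)` tends to `0` for every weakly null sequence `x` in `X`
and every weakly null sequence `f` in the dual `X*` (weakly null for `σ(X*, X**)`). -/
def HasDunfordPettisProperty (𝕜 X : Type*) [RCLike 𝕜] [NormedAddCommGroup X]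
    [NormedSpace 𝕜 X] : Prop :=
  ∀ (x : ℕ → X) (f : ℕ → StrongDual 𝕜 X), WeaklyNull 𝕜 x → WeaklyNull 𝕜 f →
    Tendsto (fun n => f n (x n)) atTop (𝓝 0)

/-- Diagonal argument: if every infinite subset of `M` can be thinned out so as to satisfy
`Q k n`, there is a sequence in `M` whose tails lie in sets satisfying `Q k (φ k)`. -/
theorem exists_strictMono_diagonal {M : Set ℕ} (hM : M.Infinite) {Q : ℕ → ℕ → Set ℕ → Prop}
    (h : ∀ k, ∀ n ∈ M, ∀ N ⊆ M, N.Infinite → ∃ N' ⊆ N, N'.Infinite ∧ Q k n N') :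
    ∃ φ : ℕ → ℕ, StrictMono φ ∧ (∀ k, φ k ∈ M) ∧
      ∃ N : ℕ → Set ℕ, ∀ k, Q k (φ k) (N k) ∧ ∀ i, k < i → φ i ∈ N k := by
  have step : ∀ k (T : {N : Set ℕ // N ⊆ M ∧ N.Infinite}),
      ∃ T' : {N : Set ℕ // N ⊆ M ∧ N.Infinite},
        T'.1 ⊆ T.1 ∩ Set.Ioi (sInf T.1) ∧ Q k (sInf T.1) T'.1 := by
    rintro k ⟨N, hN, hi⟩
    have hinf : (N ∩ Set.Ioi (sInf N)).Infinite := by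
      have : N ∩ Set.Ioi (sInf N) = N \ Set.Iic (sInf N) := by
        ext x; simp
      rw [this]
      exact hi.sdiff (Set.finite_Iic _)
    obtain ⟨N', h1, h2, h3⟩ := h k (sInf N) (hN (Nat.sInf_mem hi.nonempty)) _
      (Set.inter_subset_left.trans hN) hinf
    exact ⟨⟨N', (h1.trans Set.inter_subset_left).trans hN, h2⟩, h1, h3⟩
  choose F hF hQ using step
  let st : ℕ → {N : Set ℕ // N ⊆ M ∧ N.Infinite} :=
    fun k => Nat.rec ⟨M, subset_rfl, hM⟩ (fun k T => F k T) k
  have hst : ∀ k, st (k + 1) = F k (st k) := fun _ => rfl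
  have hsub : ∀ k, (st (k + 1)).1 ⊆ (st k).1 ∩ Set.Ioi (sInf (st k).1) := fun k => hF k (st k)
  have hanti : Antitone fun k => (st k).1 :=
    antitone_nat_of_succ_le fun k => (hsub k).trans Set.inter_subset_left
  have hmem : ∀ k, sInf (st k).1 ∈ (st k).1 := fun k => Nat.sInf_mem (st k).2.2.nonempty
  refine ⟨fun k => sInf (st k).1, strictMono_nat_of_lt_succ fun k => (hsub k (hmem (k + 1))).2,
    fun k => (st k).2.1 (hmem k), fun k => (st (k + 1)).1, fun k => ⟨hQ k (st k), ?_⟩⟩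
  exact fun i hi => hanti (Nat.succ_le_of_lt hi) (hmem i)

section Rosenthal

variable {S : Type*}

/-- Along `M`, every point of `L` eventually leaves one of the two sequences of sets
`E true`, `E false`. -/
def SettlesOn (E : Bool → ℕ → Set S) (M : Set ℕ) (L : Set S) : Prop :=
  ∀ s ∈ L, ∃ b, {n ∈ M | s ∈ E b n}.Finite

/-- No infinite subset of `M` settles on `L`. -/
def NeverSettlesOn (E : Bool → ℕ → Set S) (M : Set ℕ) (L : Set S) : Prop :=
  ∀ N ⊆ M, N.Infinite → ¬ SettlesOn E N L

theorem SettlesOn.of_diff_finite {E : Bool → ℕ → Set S} {M N : Set ℕ} {L : Set S}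
    (h : SettlesOn E M L) (hN : (N \ M).Finite) : SettlesOn E N L := by
  intro s hs
  obtain ⟨b, hb⟩ := h s hs
  refine ⟨b, (hb.union hN).subset ?_⟩
  rintro n ⟨hn, hsn⟩
  by_cases hnM : n ∈ M
  · exact Or.inl ⟨hnM, hsn⟩
  · exact Or.inr ⟨hn, hnM⟩

theorem NeverSettlesOn.mono {E : Bool → ℕ → Set S} {M N : Set ℕ} {L : Set S}
    (h : NeverSettlesOn E M L) (hN : N ⊆ M) : NeverSettlesOn E N L :=
  fun N' hN' hi => h N' (hN'.trans hN) hi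

theorem NeverSettlesOn.exists_split {E : Bool → ℕ → Set S} {𝓛 : Set (Set S)} (h𝓛 : 𝓛.Finite)
    {M : Set ℕ} (hM : M.Infinite) (hbad : ∀ L ∈ 𝓛, NeverSettlesOn E M L) :
    ∃ n ∈ M, ∃ M' ⊆ M, M'.Infinite ∧ ∀ L ∈ 𝓛, ∀ b, NeverSettlesOn E M' (L ∩ E b n) := by
  by_contra! hcon
  obtain ⟨φ, hφ, hφM, N, hN⟩ := exists_strictMono_diagonal hM
    (Q := fun _ n N => ∃ p : 𝓛 × Bool, SettlesOn E N (p.1.1 ∩ E p.2 n)) (by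
      intro _ n hn N hN hi
      obtain ⟨L, hL, b, hb⟩ := hcon n hn N hN hi
      simp only [NeverSettlesOn] at hb
      push Not at hb
      obtain ⟨N', h1, h2, h3⟩ := hb
      exact ⟨N', h1, h2, ⟨⟨L, hL⟩, b⟩, h3⟩)
  choose p hp using fun k => (hN k).1
  have : Finite 𝓛 := h𝓛
  obtain ⟨⟨L, b⟩, hJ⟩ := Finite.exists_infinite_fiber p
  rw [Set.infinite_coe_iff] at hJ
  refine hbad L L.2 (φ '' (p ⁻¹' {(L, b)})) ?_ (hJ.image hφ.injective.injOn) ?_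
  · rintro _ ⟨k, _, rfl⟩
    exact hφM k
  intro s hs
  by_cases hex : ∃ k, p k = (L, b) ∧ s ∈ E b (φ k)
  · obtain ⟨k, hk, hsk⟩ := hex
    have h1 := hp k
    rw [hk] at h1
    refine h1.of_diff_finite ?_ s ⟨hs, hsk⟩
    refine ((Set.finite_Iic k).image φ).subset ?_
    rintro _ ⟨⟨i, _, rfl⟩, hi⟩
    refine ⟨i, ?_, rfl⟩
    by_contra hik
    exact hi ((hN k).2 i (not_le.1 hik))
  · refine ⟨b, Set.Finite.subset Set.finite_empty ?_⟩
    rintro _ ⟨⟨k, hk, rfl⟩, hsk⟩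
    exact hex ⟨k, hk, hsk⟩

/-- Rosenthal's combinatorial lemma: if no subsequence settles, some subsequence of pairs of sets
is Boolean independent. -/
theorem NeverSettlesOn.exists_independent {E : Bool → ℕ → Set S} {M : Set ℕ} (hM : M.Infinite)
    (h : NeverSettlesOn E M Set.univ) :
    ∃ φ : ℕ → ℕ, StrictMono φ ∧ ∀ (ε : ℕ → Bool) (k : ℕ), ∃ s, ∀ i < k, s ∈ E (ε i) (φ i) := by
  let T := {p : Set (Set S) × Set ℕ //
    p.1.Finite ∧ p.2.Infinite ∧ ∀ L ∈ p.1, NeverSettlesOn E p.2 L}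
  have step : ∀ t : T, ∃ (n : ℕ) (t' : T), n ∈ t.1.2 ∧ t'.1.2 ⊆ t.1.2 ∩ Set.Ioi n ∧
      ∀ L ∈ t.1.1, ∀ b, L ∩ E b n ∈ t'.1.1 := by
    rintro ⟨⟨𝓛, M⟩, h𝓛, hM, hbad⟩
    obtain ⟨n, hn, M', hM', hi, h'⟩ := NeverSettlesOn.exists_split h𝓛 hM hbad
    refine ⟨n, ⟨⟨(fun q : Set S × Bool => q.1 ∩ E q.2 n) '' (𝓛 ×ˢ Set.univ), M' \ Set.Iic n⟩,
      (h𝓛.prod Set.finite_univ).image _, hi.sdiff (Set.finite_Iic n), ?_⟩, hn, ?_, ?_⟩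
    · rintro _ ⟨⟨L, b⟩, ⟨hL, _⟩, rfl⟩
      exact (h' L hL b).mono Set.sdiff_subset
    · rintro m ⟨hm, hmn⟩
      have hnm : ¬ m ≤ n := hmn
      exact ⟨hM' hm, not_le.1 hnm⟩
    · exact fun L hL b => ⟨(L, b), ⟨hL, trivial⟩, rfl⟩
  choose n F hn hF hL using step
  let st : ℕ → T := fun k => Nat.rec
    ⟨⟨{Set.univ}, M⟩, Set.finite_singleton _, hM, by rintro _ rfl; exact h⟩ (fun _ t => F t) k
  refine ⟨fun k => n (st k), strictMono_nat_of_lt_succ fun k => (hF (st k) (hn (st (k + 1)))).2,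
    fun ε k => ?_⟩
  have key : ∃ L ∈ (st k).1.1, ∀ s ∈ L, ∀ i < k, s ∈ E (ε i) (n (st i)) := by
    induction k with
    | zero => exact ⟨Set.univ, rfl, fun _ _ i hi => absurd hi (Nat.not_lt_zero i)⟩
    | succ k ih =>
      obtain ⟨L, hLk, hs⟩ := ih
      refine ⟨L ∩ E (ε k) (n (st k)), hL (st k) L hLk _, fun s hsL i hi => ?_⟩
      rcases Nat.lt_succ_iff_lt_or_eq.1 hi with hi | rfl
      · exact hs s hsL.1 i hi
      · exact hsL.2
  obtain ⟨L, hLk, hs⟩ := key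
  by_contra! hcon
  refine (st k).2.2.2 L hLk _ subset_rfl (st k).2.2.1 fun s hsL => ?_
  obtain ⟨i, hi, hsi⟩ := hcon s
  exact absurd (hs s hsL i hi) hsi

end Rosenthal

section EllOneSequence

variable {𝕜 E : Type*} [RCLike 𝕜] [NormedAddCommGroup E] [NormedSpace 𝕜 E]

/-- The sequence `x` is equivalent to the unit vector basis of `ℓ¹`: it is bounded, and the norms
of its linear combinations dominate the `ℓ¹`-norms of the coefficients. -/
def IsEllOneSequence (𝕜 : Type*) {E : Type*} [RCLike 𝕜] [NormedAddCommGroup E] [NormedSpace 𝕜 E]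
    (x : ℕ → E) : Prop :=
  (∃ C, ∀ n, ‖x n‖ ≤ C) ∧
    ∃ δ > 0, ∀ (s : Finset ℕ) (c : ℕ → 𝕜), δ * ∑ i ∈ s, ‖c i‖ ≤ ‖∑ i ∈ s, c i • x i‖

theorem RCLike.exists_signs_half_sum_norm_le (s : Finset ℕ) (c : ℕ → 𝕜) :
    ∃ ε : ℕ → Bool, (∑ i ∈ s, ‖c i‖) / 2 ≤ ‖∑ i ∈ s, c i * (if ε i then 1 else -1)‖ := by
  have hsum : ∑ i ∈ s, ‖c i‖ ≤ ∑ i ∈ s, |RCLike.re (c i)| + ∑ i ∈ s, |RCLike.im (c i)| := by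
    rw [← Finset.sum_add_distrib]
    refine Finset.sum_le_sum fun i _ => ?_
    calc ‖c i‖ = ‖(RCLike.re (c i) : 𝕜) + RCLike.im (c i) * RCLike.I‖ := by rw [RCLike.re_add_im]
      _ ≤ ‖(RCLike.re (c i) : 𝕜)‖ + ‖(RCLike.im (c i) : 𝕜) * RCLike.I‖ := norm_add_le _ _
      _ ≤ |RCLike.re (c i)| + |RCLike.im (c i)| * 1 := by
        rw [norm_mul, RCLike.norm_ofReal, RCLike.norm_ofReal]
        gcongr
        by_cases hI : (RCLike.I : 𝕜) = 0
        · simp [hI]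
        · exact (RCLike.norm_I_of_ne_zero hI).le
      _ = _ := by rw [mul_one]
  rcases le_total (∑ i ∈ s, |RCLike.im (c i)|) (∑ i ∈ s, |RCLike.re (c i)|) with h | h
  · refine ⟨fun i => decide (0 ≤ RCLike.re (c i)), ?_⟩
    refine le_trans ?_ (RCLike.re_le_norm _)
    have : RCLike.re (∑ i ∈ s, c i * (if decide (0 ≤ RCLike.re (c i)) then 1 else -1)) =
        ∑ i ∈ s, |RCLike.re (c i)| := by
      rw [map_sum]
      refine Finset.sum_congr rfl fun i _ => ?_
      by_cases hi : 0 ≤ RCLike.re (c i)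
      · simp [hi, abs_of_nonneg hi]
      · simp [hi, abs_of_neg (not_le.1 hi)]
    linarith
  · refine ⟨fun i => decide (0 ≤ RCLike.im (c i)), ?_⟩
    refine le_trans ?_ ((le_abs_self _).trans (RCLike.abs_im_le_norm _))
    have : RCLike.im (∑ i ∈ s, c i * (if decide (0 ≤ RCLike.im (c i)) then 1 else -1)) =
        ∑ i ∈ s, |RCLike.im (c i)| := by
      rw [map_sum]
      refine Finset.sum_congr rfl fun i _ => ?_
      by_cases hi : 0 ≤ RCLike.im (c i)
      · simp [hi, abs_of_nonneg hi]
      · simp [hi, abs_of_neg (not_le.1 hi)]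
    linarith

/-- A lower `ℓ¹`-estimate from functionals in the unit ball whose values on `x` realise, up to a
small error, every pattern of two prescribed values. -/
theorem isEllOneSequence_of_separated {x : ℕ → E} (hx : ∃ C, ∀ n, ‖x n‖ ≤ C) (p : Bool → 𝕜)
    (h : ∀ (ε : ℕ → Bool) (k : ℕ), ∃ f : StrongDual 𝕜 E, ‖f‖ ≤ 1 ∧
      ∀ i < k, ‖f (x i) - p (ε i)‖ < ‖p true - p false‖ / 8) : IsEllOneSequence 𝕜 x := by
  set d := ‖p true - p false‖ with hd
  have hd0 : 0 < d := by
    obtain ⟨f, -, hf⟩ := h (fun _ => true) 1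
    have := (norm_nonneg _).trans_lt (hf 0 one_pos)
    linarith
  refine ⟨hx, d / 8, by positivity, fun s c => ?_⟩
  obtain ⟨ε, hε⟩ := RCLike.exists_signs_half_sum_norm_le s c
  obtain ⟨k, hk⟩ : ∃ k, ∀ i ∈ s, i < k :=
    ⟨s.sup id + 1, fun i hi => Nat.lt_succ_of_le (Finset.le_sup (f := id) hi)⟩
  obtain ⟨f, hf, hfx⟩ := h ε k
  obtain ⟨g, hg, hgx⟩ := h (fun i => !ε i) k
  have hfg : ‖f - g‖ ≤ 2 := (norm_sub_le f g).trans (by linarith)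
  have h1 : ‖(f - g) (∑ i ∈ s, c i • x i)‖ ≤ 2 * ‖∑ i ∈ s, c i • x i‖ :=
    (f - g).le_of_opNorm_le hfg _
  have h2 : (f - g) (∑ i ∈ s, c i • x i) =
      (p true - p false) * (∑ i ∈ s, c i * (if ε i then 1 else -1)) +
      ∑ i ∈ s, c i * ((f (x i) - p (ε i)) - (g (x i) - p (!ε i))) := by
    rw [map_sum, Finset.mul_sum, ← Finset.sum_add_distrib]
    refine Finset.sum_congr rfl fun i _ => ?_
    simp only [map_smul, _root_.sub_apply, smul_eq_mul]
    cases ε i <;> simp <;> ring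
  have h3 : ‖∑ i ∈ s, c i * ((f (x i) - p (ε i)) - (g (x i) - p (!ε i)))‖ ≤
      d / 4 * ∑ i ∈ s, ‖c i‖ := by
    rw [Finset.mul_sum]
    refine norm_sum_le_of_le _ fun i hi => ?_
    rw [norm_mul, mul_comm]
    refine mul_le_mul_of_nonneg_right ?_ (norm_nonneg _)
    have := hfx i (hk i hi)
    have := hgx i (hk i hi)
    exact (norm_sub_le _ _).trans (by linarith)
  have h4 : d * ((∑ i ∈ s, ‖c i‖) / 2) ≤
      ‖(p true - p false) * (∑ i ∈ s, c i * (if ε i then 1 else -1))‖ := by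
    rw [norm_mul]
    exact mul_le_mul_of_nonneg_left hε hd0.le
  have h5 := norm_sub_le ((f - g) (∑ i ∈ s, c i • x i))
    (∑ i ∈ s, c i * ((f (x i) - p (ε i)) - (g (x i) - p (!ε i))))
  rw [h2, add_sub_cancel_right, ← h2] at h5
  linarith

/-- **Rosenthal's `ℓ¹` theorem**: a bounded sequence has a weakly Cauchy subsequence or a
subsequence equivalent to the unit vector basis of `ℓ¹`. -/
theorem exists_weaklyCauchy_or_isEllOneSequence (𝕜 : Type*) {E : Type*} [RCLike 𝕜]
    [NormedAddCommGroup E] [NormedSpace 𝕜 E] {x : ℕ → E} {C : ℝ} (hx : ∀ n, ‖x n‖ ≤ C) :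
    (∃ φ : ℕ → ℕ, StrictMono φ ∧
      ∀ f : StrongDual 𝕜 E, ∃ l, Tendsto (fun n => f (x (φ n))) atTop (𝓝 l)) ∨
    ∃ φ : ℕ → ℕ, StrictMono φ ∧ IsEllOneSequence 𝕜 fun n => x (φ n) := by
  let p : ℕ → Bool → 𝕜 := fun k b =>
    if b then (TopologicalSpace.denseSeq (𝕜 × 𝕜) k).1 else (TopologicalSpace.denseSeq (𝕜 × 𝕜) k).2
  let A : ℕ → Bool → ℕ → Set (StrongDual 𝕜 E) := fun k b n =>
    {f | ‖f‖ ≤ 1 ∧ ‖f (x n) - p k b‖ < ‖p k true - p k false‖ / 8}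
  by_cases hcase : ∃ k M, M.Infinite ∧ NeverSettlesOn (A k) M Set.univ
  · obtain ⟨k, M, hM, hnever⟩ := hcase
    obtain ⟨φ, hφ, hind⟩ := hnever.exists_independent hM
    refine Or.inr ⟨φ, hφ, isEllOneSequence_of_separated ⟨C, fun n => hx _⟩ (p k) fun ε m => ?_⟩
    obtain ⟨f, hf⟩ := hind ε (m + 1)
    exact ⟨f, (hf 0 m.succ_pos).1, fun i hi => (hf i (hi.trans m.lt_succ_self)).2⟩
  left
  obtain ⟨φ, hφ, -, N, hN⟩ := exists_strictMono_diagonal Set.infinite_univ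
    (Q := fun k _ N => SettlesOn (A k) N Set.univ) (by
      intro k _ _ M _ hM
      by_contra! hcon
      exact hcase ⟨k, M, hM, hcon⟩)
  refine ⟨φ, hφ, ?_⟩
  have hset : ∀ k, SettlesOn (A k) (Set.range φ) Set.univ := by
    refine fun k => (hN k).1.of_diff_finite (((Set.finite_Iic k).image φ).subset ?_)
    rintro _ ⟨⟨i, rfl⟩, hi⟩
    refine ⟨i, ?_, rfl⟩
    by_contra hik
    exact hi ((hN k).2 i (not_le.1 hik))
  have hball : ∀ f : StrongDual 𝕜 E, ‖f‖ ≤ 1 →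
      ∃ l, Tendsto (fun n => f (x (φ n))) atTop (𝓝 l) := by
    intro f hf
    have hK : IsCompact (Metric.closedBall (0 : 𝕜) C) := isCompact_closedBall _ _
    have hmem : ∀ n, f (x (φ n)) ∈ Metric.closedBall (0 : 𝕜) C := fun n => by
      rw [mem_closedBall_zero_iff]
      exact ((f.le_of_opNorm_le hf _).trans_eq (one_mul _)).trans (hx _)
    obtain ⟨a, -, ha⟩ := hK.exists_mapClusterPt (f := atTop) (u := fun n => f (x (φ n)))
      (tendsto_principal.2 (Eventually.of_forall hmem))
    refine ⟨a, hK.tendsto_nhds_of_unique_mapClusterPt (Eventually.of_forall hmem)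
      fun b _ hb => ?_⟩
    by_contra hne
    have hd : 0 < ‖a - b‖ := norm_pos_iff.2 (sub_ne_zero.2 (Ne.symm hne))
    obtain ⟨k, hk⟩ := (TopologicalSpace.denseRange_denseSeq (𝕜 × 𝕜)).exists_dist_lt (a, b)
      (ε := ‖a - b‖ / 100) (by positivity)
    rw [Prod.dist_eq, max_lt_iff, dist_eq_norm, dist_eq_norm] at hk
    change ‖a - p k true‖ < _ ∧ ‖b - p k false‖ < _ at hk
    have hpk : ‖a - b‖ * (98 / 100) ≤ ‖p k true - p k false‖ := by
      have h1 := norm_add₃_le (a := a - p k true) (b := p k true - p k false)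
        (c := p k false - b)
      rw [norm_sub_rev (p k false) b, sub_add_sub_cancel, sub_add_sub_cancel] at h1
      linarith
    have key : ∀ v c, MapClusterPt v atTop (fun n => f (x (φ n))) →
        ‖v - p k c‖ < ‖a - b‖ / 100 → ¬ {n ∈ Set.range φ | f ∈ A k c n}.Finite := by
      intro v c hv hvc hfin
      have hfr := hv.frequently (Metric.ball_mem_nhds v (ε := ‖a - b‖ / 100) (by positivity))
      rw [Nat.frequently_atTop_iff_infinite] at hfr
      refine (hfr.image hφ.injective.injOn) (hfin.subset ?_)
      rintro _ ⟨n, hn, rfl⟩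
      refine ⟨⟨n, rfl⟩, hf, ?_⟩
      have hn' : ‖f (x (φ n)) - v‖ < ‖a - b‖ / 100 := mem_ball_iff_norm.1 hn
      have h1 := norm_add_le (f (x (φ n)) - v) (v - p k c)
      rw [sub_add_sub_cancel] at h1
      linarith
    obtain ⟨c, hc⟩ := hset k f trivial
    cases c
    · exact key b false hb hk.2 hc
    · exact key a true ha hk.1 hc
  intro f
  obtain ⟨l, hl⟩ := hball (((‖f‖ + 1 : ℝ) : 𝕜)⁻¹ • f) (by
    rw [norm_smul, norm_inv, RCLike.norm_ofReal, abs_of_pos (by positivity)]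
    exact inv_mul_le_one_of_le₀ (by linarith) (by positivity))
  refine ⟨((‖f‖ + 1 : ℝ) : 𝕜) * l, (hl.const_mul _).congr fun n => ?_⟩
  have : ((‖f‖ + 1 : ℝ) : 𝕜) ≠ 0 := by
    rw [Ne, RCLike.ofReal_eq_zero]
    positivity
  rw [_root_.smul_apply, smul_eq_mul, mul_inv_cancel_left₀ this]

end EllOneSequence

section EllOneSubspace

variable {𝕜 E : Type*} [RCLike 𝕜] [NormedAddCommGroup E] [NormedSpace 𝕜 E]

theorem IsEllOneSequence.exists_forall_dual_apply_eq {x : ℕ → E} (hx : IsEllOneSequence 𝕜 x) :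
    ∃ K, ∀ θ : ℕ → 𝕜, (∀ j, ‖θ j‖ ≤ 1) →
      ∃ f : StrongDual 𝕜 E, ‖f‖ ≤ K ∧ ∀ j, f (x j) = θ j := by
  obtain ⟨-, δ, hδ, hlow⟩ := hx
  refine ⟨δ⁻¹, fun θ hθ => ?_⟩
  let T := Finsupp.linearCombination 𝕜 x
  have hT : ∀ c, δ * ∑ i ∈ c.support, ‖c i‖ ≤ ‖T c‖ := fun c => hlow c.support c
  have hinj : Function.Injective T := by
    refine (injective_iff_map_eq_zero T).2 fun c hc => ?_
    have h1 := hT c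
    rw [hc, norm_zero] at h1
    have h2 : ∑ i ∈ c.support, ‖c i‖ = 0 :=
      le_antisymm (by by_contra! h; exact (mul_pos hδ h).not_ge h1)
        (Finset.sum_nonneg fun _ _ => norm_nonneg _)
    rw [Finset.sum_eq_zero_iff_of_nonneg fun _ _ => norm_nonneg _] at h2
    ext i
    by_cases hi : i ∈ c.support
    · exact norm_eq_zero.1 (h2 i hi)
    · exact Finsupp.notMem_support_iff.1 hi
  let e := LinearEquiv.ofInjective T hinj
  let F : LinearMap.range T →ₗ[𝕜] 𝕜 := Finsupp.linearCombination 𝕜 θ ∘ₗ e.symm.toLinearMap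
  have hF : ∀ y, ‖F y‖ ≤ δ⁻¹ * ‖y‖ := by
    intro y
    obtain ⟨c, rfl⟩ := e.surjective y
    have h1 : F (e c) = ∑ i ∈ c.support, c i * θ i := by
      simp [F, Finsupp.linearCombination_apply, Finsupp.sum]
    have h2 : ‖F (e c)‖ ≤ ∑ i ∈ c.support, ‖c i‖ := by
      rw [h1]
      refine norm_sum_le_of_le _ fun i _ => ?_
      rw [norm_mul]
      exact mul_le_of_le_one_right (norm_nonneg _) (hθ i)
    refine h2.trans ?_
    rw [inv_mul_eq_div, le_div_iff₀' hδ]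
    exact hT c
  obtain ⟨f, hf, hnorm⟩ := exists_extension_norm_eq (LinearMap.range T) (F.mkContinuous δ⁻¹ hF)
  refine ⟨f, hnorm.trans_le (F.mkContinuous_norm_le (inv_nonneg.2 hδ.le) hF), fun j => ?_⟩
  have h1 : (e (Finsupp.single j 1) : E) = x j := by simp [e, T]
  rw [← h1, hf, LinearMap.mkContinuous_apply]
  simp [F]

/-- If a normed space contains a copy of `ℓ¹`, so does its dual. -/
theorem IsEllOneSequence.exists_dual {x : ℕ → E} (hx : IsEllOneSequence 𝕜 x) :
    ∃ f : ℕ → StrongDual 𝕜 E, IsEllOneSequence 𝕜 f := by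
  obtain ⟨K, hK⟩ := hx.exists_forall_dual_apply_eq
  obtain ⟨⟨C, hC⟩, -⟩ := hx
  have hC0 : 0 ≤ C := (norm_nonneg _).trans (hC 0)
  let D : ℕ → Finset ℕ := fun j => (Encodable.decode j).getD ∅
  choose f hf hfx using fun n : ℕ => hK (fun j => if n ∈ D j then 1 else -1) fun j => by
    split_ifs <;> simp
  refine ⟨f, ⟨K, hf⟩, (2 * (C + 1))⁻¹, by positivity, fun s c => ?_⟩
  obtain ⟨ε, hε⟩ := RCLike.exists_signs_half_sum_norm_le s c
  set j := Encodable.encode (s.filter fun i => ε i)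
  have hD : D j = s.filter fun i => ε i := by simp [D, j]
  have h1 : (∑ i ∈ s, c i • f i) (x j) = ∑ i ∈ s, c i * (if ε i then 1 else -1) := by
    rw [sum_apply]
    refine Finset.sum_congr rfl fun i hi => ?_
    simp [hfx, hD, hi]
  have h2 := (∑ i ∈ s, c i • f i).le_opNorm (x j)
  rw [h1] at h2
  rw [inv_mul_eq_div, div_le_iff₀ (by positivity)]
  have h3 : ‖∑ i ∈ s, c i • f i‖ * ‖x j‖ ≤ ‖∑ i ∈ s, c i • f i‖ * (C + 1) :=
    mul_le_mul_of_nonneg_left ((hC j).trans (by linarith)) (norm_nonneg _)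
  linarith

theorem IsEllOneSequence.exists_isClosed_equiv_lp [CompleteSpace E] {x : ℕ → E}
    (hx : IsEllOneSequence 𝕜 x) : ∃ Y : Submodule 𝕜 E, IsClosed (Y : Set E) ∧
      Nonempty (Y ≃L[𝕜] lp (fun _ : ℕ => 𝕜) 1) := by
  obtain ⟨⟨C, hC⟩, δ, hδ, hlow⟩ := hx
  have hnorm : ∀ c : lp (fun _ : ℕ => 𝕜) 1, HasSum (fun i => ‖c i‖) ‖c‖ := fun c => by
    simpa using lp.hasSum_norm (p := 1) (by simp) c
  have hle : ∀ (c : lp (fun _ : ℕ => 𝕜) 1) i, ‖c i • x i‖ ≤ ‖c i‖ * C := fun c i => by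
    rw [norm_smul]
    exact mul_le_mul_of_nonneg_left (hC i) (norm_nonneg _)
  have hsum : ∀ c : lp (fun _ : ℕ => 𝕜) 1, Summable fun i => c i • x i := fun c =>
    Summable.of_norm_bounded ((hnorm c).summable.mul_right C) (hle c)
  let T₀ : lp (fun _ : ℕ => 𝕜) 1 →ₗ[𝕜] E :=
    { toFun := fun c => ∑' i, c i • x i
      map_add' := fun c d => by
        rw [← (hsum c).tsum_add (hsum d)]
        exact tsum_congr fun i => add_smul _ _ _
      map_smul' := fun a c => by
        rw [RingHom.id_apply, ← (hsum c).tsum_const_smul a]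
        exact tsum_congr fun i => mul_smul _ _ _ }
  let T : lp (fun _ : ℕ => 𝕜) 1 →L[𝕜] E := T₀.mkContinuous C fun c => by
    rw [mul_comm]
    exact tsum_of_norm_bounded ((hnorm c).mul_right C) (hle c)
  have hT : ∀ c, δ * ‖c‖ ≤ ‖T c‖ := fun c =>
    le_of_tendsto_of_tendsto' ((hnorm c).const_mul δ) (hsum c).hasSum.norm fun s => hlow s c
  have hanti : AntilipschitzWith (Real.toNNReal δ⁻¹) T := by
    refine T.antilipschitz_of_bound fun c => ?_
    rw [Real.coe_toNNReal _ (inv_nonneg.2 hδ.le), inv_mul_eq_div, le_div_iff₀' hδ]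
    exact hT c
  have hclosed : IsClosed (Set.range T) := hanti.isClosed_range T.uniformContinuous
  exact ⟨(T : lp (fun _ : ℕ => 𝕜) 1 →ₗ[𝕜] E).range, hclosed, ⟨(T.equivRange hanti.injective hclosed).symm⟩⟩

theorem weaklyNull_of_forall_tendsto {x : ℕ → E}
    (h : ∀ f : StrongDual 𝕜 E, Tendsto (fun n => f (x n)) atTop (𝓝 0)) : WeaklyNull 𝕜 x := by
  have hinj : Function.Injective (topDualPairing 𝕜 E).flip := by
    refine (injective_iff_map_eq_zero _).2 fun v hv => ?_
    exact SeparatingDual.eq_zero_of_forall_dual_eq_zero (R := 𝕜) fun f => LinearMap.congr_fun hv f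
  refine (WeakBilin.tendsto_iff_forall_eval_tendsto _ hinj).2 fun f => ?_
  have h0 := h f
  rw [← map_zero f] at h0
  exact h0

end EllOneSubspace

/-- In a space with the Dunford–Pettis property, a weakly Cauchy sequence of functionals takes
arbitrarily small values along a weakly null sequence. -/
theorem HasDunfordPettisProperty.exists_norm_apply_lt {𝕜 X : Type*} [RCLike 𝕜]
    [NormedAddCommGroup X] [NormedSpace 𝕜 X] (hX : HasDunfordPettisProperty 𝕜 X) {x : ℕ → X}
    {f : ℕ → StrongDual 𝕜 X} (hx : ∀ g : StrongDual 𝕜 X, Tendsto (fun n => g (x n)) atTop (𝓝 0))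
    (hf : ∀ F : StrongDual 𝕜 (StrongDual 𝕜 X), ∃ l, Tendsto (fun n => F (f n)) atTop (𝓝 l))
    {r : ℝ} (hr : 0 < r) : ∃ n, ‖f n (x n)‖ < r := by
  by_contra! hcon
  have hex : ∀ n, ∃ k, n ≤ k ∧ ‖f n (x k)‖ < r / 2 := fun n => by
    have h1 : ∀ᶠ k in atTop, ‖f n (x k)‖ < r / 2 :=
      (tendsto_zero_iff_norm_tendsto_zero.1 (hx (f n))).eventually_lt_const (by positivity)
    exact ((eventually_ge_atTop n).and h1).exists
  choose k hk hk' using hex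
  have hktop : Tendsto k atTop atTop := tendsto_atTop_mono hk tendsto_id
  have hlim := hX (fun n => x (k n)) (fun n => f (k n) - f n)
    (weaklyNull_of_forall_tendsto fun g => (hx g).comp hktop)
    (weaklyNull_of_forall_tendsto fun F => by
      obtain ⟨l, hl⟩ := hf F
      simpa using (hl.comp hktop).sub hl)
  obtain ⟨n, hn⟩ := ((tendsto_zero_iff_norm_tendsto_zero.1 hlim).eventually_lt_const
    (half_pos hr)).exists
  have h1 := norm_sub_norm_le (f (k n) (x (k n))) (f n (x (k n)))
  rw [_root_.sub_apply] at hn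
  linarith [hcon (k n), hk' n]

theorem mainTheorem6 {𝕜 X : Type*} [RCLike 𝕜] [NormedAddCommGroup X] [NormedSpace 𝕜 X]
    [CompleteSpace X] (hdim : ¬ FiniteDimensional 𝕜 X) (hX : HasDunfordPettisProperty 𝕜 X) :
    ∃ Y : Submodule 𝕜 (StrongDual 𝕜 X), IsClosed (Y : Set (StrongDual 𝕜 X)) ∧
      Nonempty (Y ≃L[𝕜] lp (fun _ : ℕ => 𝕜) 1) := by
  suffices ∃ f : ℕ → StrongDual 𝕜 X, IsEllOneSequence 𝕜 f by
    obtain ⟨f, hf⟩ := this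
    exact hf.exists_isClosed_equiv_lp
  obtain ⟨R, u, -, hu, hsep⟩ := exists_seq_norm_le_one_le_norm_sub (𝕜 := 𝕜) hdim
  rcases exists_weaklyCauchy_or_isEllOneSequence 𝕜 hu with ⟨φ, hφ, hlim⟩ | ⟨φ, -, hφ⟩
  swap
  · exact hφ.exists_dual
  set x : ℕ → X := fun n => u (φ (n + 1)) - u (φ n) with hxdef
  have hxnorm : ∀ n, 1 ≤ ‖x n‖ := fun n => hsep (hφ n.lt_succ_self).ne'
  have hxnull : ∀ g : StrongDual 𝕜 X, Tendsto (fun n => g (x n)) atTop (𝓝 0) := fun g => by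
    obtain ⟨l, hl⟩ := hlim g
    simpa [hxdef] using ((tendsto_add_atTop_iff_nat 1).2 hl).sub hl
  choose g hg hgx using fun n => exists_dual_vector'' 𝕜 (x n)
  rcases exists_weaklyCauchy_or_isEllOneSequence 𝕜 hg with ⟨ψ, hψ, hlim'⟩ | ⟨ψ, -, hψ⟩
  swap
  · exact ⟨_, hψ⟩
  obtain ⟨n, hn⟩ := hX.exists_norm_apply_lt (x := fun n => x (ψ n)) (f := fun n => g (ψ n))
    (fun F => (hxnull F).comp hψ.tendsto_atTop) hlim' one_pos
  rw [hgx, RCLike.norm_ofReal, abs_norm] at hn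
  exact absurd (hxnorm (ψ n)) hn.not_ge
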